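/- Let $R$ be a commutative ring. Let $\mathrm{inj}_R$ (respectively $\mathrm{pinj}_R$) be the set of isomorphism types of indecomposable injective (respectively indecomposable pure-injective) $R$-modules, so $\mathrm{inj}_R\subseteq\mathrm{pinj}_R$. For $P\in\mathrm{Spec}(R)$ let $E(R/P)$ be the injective hull of $R/P$; it is indecomposable. A pp formula $\varphi(x_1,\dots,x_n)$ is an existentially quantified finite system of homogeneous $R$-linear equations, $\varphi(M)\subseteq M^n$ is its solution set in the $R$-module $M$, and the pp-type of an element of a module is the set of pp formulas in one free variable which it satisfies there. An ideal of $R$ is pp-definable if it has the form $\varphi(R)$ for some pp formula $\varphi$ in one free variable. Consider the following topologies. - The full support topology on $\mathrm{pinj}_R$ is generated by the sets $(p/\psi)$, with $p$ the pp-type of an element of some $R$-module and $\psi$ a pp formula in one free variable, where $N\in(p/\psi)$ iff some $a\in N$ satisfies all formulas in $p$ but not $\psi$. - The Ziegler topology on $\mathrm{pinj}_R$ is generated by the sets $(\varphi/\psi)=\{N : \varphi(N)\not\subseteq\psi(N)\}$, with $\varphi,\psi$ pp formulas in the same finite number of free variables. - The Thomason (Zariski*) topology on $\mathrm{inj}_R$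 is generated by the sets $(R/I)=\{E : \mathrm{Hom}_R(R/I,E)\neq 0\}$, with $I$ a finitely generated ideal. Then the map $\mathrm{Spec}(R)\to\mathrm{inj}_R$, $P\mapsto E(R/P)$, is injective, and, writing $V(I)=\{P\in\mathrm{Spec}(R): I\subseteq P\}$, the topologies induced on $\mathrm{Spec}(R)$ via this map have the following open sets: 1. full support topology: exactly the unions $\bigcup_\lambda V(I_\lambda)$ for arbitrary sets $\{I_\lambda\}_\lambda$ of ideals; equivalently, exactly the specialisation-closed subsets of $\mathrm{Spec}(R)$ (those which, with $P$, contain every prime $Q\supseteq P$); 2. Ziegler topology: exactly the unions $\bigcup_\lambda V(I_\lambda)$ for sets $\{I_\lambda\}_\lambda$ of pp-definable ideals; 3. Thomason (Zariski*) topology: exactly the unions $\bigcup_\lambda V(I_\lambda)$ for sets $\{I_\lambda\}_\lambda$ of finitely generated ideals. If $R$ is coherent (every finitely generated ideal is finitely presented), the induced topologies in 2 and 3 coincide; if $R$ is noetherian, all three coincide. -/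

import Mathlib

open scoped Topology

universe u v

namespace ZieglerSpec

/-! ### Positive primitive formulas -/

/-- A pp formula `φ(x₁, …, xₙ)` over `R`: an existentially quantified finite system of homogeneous
`R`-linear equations `∃ y₁ … y_k, ⋀ᵢ ∑ⱼ aᵢⱼ xⱼ + ∑ⱼ bᵢⱼ yⱼ = 0`. -/
structure PPFormula (R : Type u) (n : ℕ) where
  /-- number of existentially quantified variables -/
  k : ℕ
  /-- number of equations -/
  l : ℕ
  /-- coefficients of the free variables -/
  a : Fin l → Fin n → R
  /-- coefficients of the quantified variables -/
  b : Fin l → Fin k → R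

/-- The solution set `φ(M) ⊆ Mⁿ` of a pp formula in a module. -/
def PPFormula.solutions {R : Type u} [CommRing R] {n : ℕ} (φ : PPFormula R n)
    (M : Type v) [AddCommGroup M] [Module R M] : Set (Fin n → M) :=
  {x | ∃ y : Fin φ.k → M, ∀ i, ∑ j, φ.a i j • x j + ∑ j, φ.b i j • y j = 0}

/-- The pp-type `pp^M(a)` of an element `a` of a module `M`: all the pp formulas in one free
variable that `a` satisfies in `M`. -/
def ppType (R : Type u) [CommRing R] {M : Type v} [AddCommGroup M] [Module R M] (a : M) :
    Set (PPFormula R 1) :=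
  {φ | (fun _ => a) ∈ φ.solutions M}

/-- An ideal of the commutative ring `R` is pp-definable if it is the solution set `φ(R)` of a
pp formula in one free variable. -/
def IsPPDefinable {R : Type u} [CommRing R] (I : Ideal R) : Prop :=
  ∃ φ : PPFormula R 1, ∀ r : R, r ∈ I ↔ (fun _ => r) ∈ φ.solutions R

/-- A commutative ring is coherent if each finitely generated ideal is finitely presented. -/
def IsCoherentRing (R : Type u) [CommRing R] : Prop :=
  ∀ I : Ideal R, I.FG → Module.FinitePresentation R I

/-! ### Pure-injective, indecomposable modules, and injective hulls -/

/-- A pure embedding: an injective linear map `f : A → B` with `φ(A) = Aⁿ ∩ φ(B)` for all pp `φ`. -/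
def IsPureEmbedding {R : Type u} [CommRing R] {A B : Type u} [AddCommGroup A] [Module R A]
    [AddCommGroup B] [Module R B] (f : A →ₗ[R] B) : Prop :=
  Function.Injective f ∧
    ∀ (n : ℕ) (φ : PPFormula R n) (x : Fin n → A),
      (fun i => f (x i)) ∈ φ.solutions B → x ∈ φ.solutions A

/-- `N` is pure-injective: it is injective over pure embeddings. -/
def IsPureInjective (R : Type u) [CommRing R] (N : Type u) [AddCommGroup N] [Module R N] : Prop :=
  ∀ ⦃A B : Type u⦄ [AddCommGroup A] [Module R A] [AddCommGroup B] [Module R B]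
    (f : A →ₗ[R] B), IsPureEmbedding f → ∀ g : A →ₗ[R] N, ∃ h : B →ₗ[R] N, ∀ x, h (f x) = g x

/-- A module is indecomposable if it is nonzero and not a direct sum of two nonzero submodules. -/
def IsIndecomposable (R : Type u) [CommRing R] (N : Type u) [AddCommGroup N] [Module R N] : Prop :=
  Nontrivial N ∧ ∀ A B : Submodule R N, IsCompl A B → A = ⊥ ∨ B = ⊥

/-- `f : M → E` is an injective hull of `M`: `E` is injective and `f` is an essential embedding. -/
structure IsInjectiveHull {R : Type u} [CommRing R] {M E : Type u} [AddCommGroup M] [Module R M]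
    [AddCommGroup E] [Module R E] (f : M →ₗ[R] E) : Prop where
  injective_module : Module.Injective R E
  injective_map : Function.Injective f
  essential : ∀ N : Submodule R E, N ⊓ LinearMap.range f = ⊥ → N = ⊥

/-- Every module has an injective hull. -/
theorem exists_injectiveHull (R : Type u) [CommRing R] (M : Type u) [AddCommGroup M] [Module R M] :
    ∃ (E : ModuleCat.{u} R) (f : M →ₗ[R] E), IsInjectiveHull f := by
  obtain ⟨Q, hQ, i, hi⟩ : ∃ (Q : ModuleCat.{u} R), Module.Injective R Q ∧
      ∃ i : M →ₗ[R] Q, Function.Injective i := by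
    obtain ⟨J, hJ, f, hf⟩ := CategoryTheory.EnoughInjectives.presentation (ModuleCat.of R M)
    have hJ' : CategoryTheory.Injective (ModuleCat.of R J) := hJ
    exact ⟨J, Module.injective_module_of_injective_object R J,
      f.hom, (ModuleCat.mono_iff_injective f).mp hf⟩
  set M₀ : Submodule R Q := LinearMap.range i with hM₀
  let S : Set (Submodule R Q) :=
    {E | M₀ ≤ E ∧ ∀ x ∈ E, x ≠ 0 → ∃ r : R, r • x ∈ M₀ ∧ r • x ≠ 0}
  have hM₀S : M₀ ∈ S := ⟨le_rfl, fun x hx h0 => ⟨1, by simpa using hx, by simpa using h0⟩⟩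
  obtain ⟨E, -, hE⟩ := zorn_le_nonempty₀ S (fun c hc hch E₁ hE₁ => by
    refine ⟨sSup c, ⟨(hc hE₁).1.trans (le_sSup hE₁), fun x hx h0 => ?_⟩, fun z hz => le_sSup hz⟩
    obtain ⟨E₂, hE₂, hx₂⟩ := (Submodule.mem_sSup_of_directed ⟨E₁, hE₁⟩ hch.directedOn).1 hx
    exact (hc hE₂).2 x hx₂ h0) M₀ hM₀S
  let T : Set (Submodule R Q) := {C | Disjoint E C}
  obtain ⟨C, -, hC⟩ := zorn_le_nonempty₀ T (fun c hc hch C₁ hC₁ => by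
    refine ⟨sSup c, Submodule.disjoint_def.2 fun x hxE hx => ?_, fun z hz => le_sSup hz⟩
    obtain ⟨C₂, hC₂, hx₂⟩ := (Submodule.mem_sSup_of_directed ⟨C₁, hC₁⟩ hch.directedOn).1 hx
    exact Submodule.disjoint_def.1 (hc hC₂) x hxE hx₂) ⊥ (disjoint_bot_right)
  have hdis : Disjoint E C := hC.prop
  obtain ⟨g, hg⟩ := hQ.out (C.mkQ ∘ₗ E.subtype) (by
    rw [← LinearMap.ker_eq_bot, LinearMap.ker_eq_bot']
    intro x hx
    have hxC : (x : Q) ∈ C := by simpa using hx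
    exact Subtype.ext (Submodule.disjoint_def.1 hdis _ x.2 hxC)) E.subtype
  have hgE : ∀ x ∈ E, g (C.mkQ x) = x := fun x hx => hg ⟨x, hx⟩
  have hrange : LinearMap.range g = E := by
    refine (hE.eq_of_le (y := LinearMap.range g) ⟨?_, ?_⟩ ?_).symm
    · intro x hx
      exact ⟨C.mkQ x, hgE x (hE.prop.1 hx)⟩
    · rintro _ ⟨z, rfl⟩ h0
      obtain ⟨q, rfl⟩ := C.mkQ_surjective z
      have hq : q ∉ C := fun hq => h0 (by
        rw [Submodule.mkQ_apply, (Submodule.Quotient.mk_eq_zero C).2 hq, map_zero])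
      have hnd : ¬ Disjoint E (C ⊔ Submodule.span R {q}) := fun hd =>
        hq ((hC.eq_of_le (y := C ⊔ Submodule.span R {q}) hd le_sup_left).symm ▸
          (le_sup_right : _ ≤ C ⊔ Submodule.span R {q}) (Submodule.mem_span_singleton_self q))
      rw [Submodule.disjoint_def] at hnd
      push Not at hnd
      obtain ⟨e, heE, he, he0⟩ := hnd
      obtain ⟨c, hc, y, hy, rfl⟩ := Submodule.mem_sup.1 he
      obtain ⟨r, rfl⟩ := Submodule.mem_span_singleton.1 hy
      have h1 := hgE _ heE
      have h2 : C.mkQ (c + r • q) = r • C.mkQ q := by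
        rw [map_add, map_smul, Submodule.mkQ_apply, (Submodule.Quotient.mk_eq_zero C).2 hc,
          zero_add]
      rw [h2, map_smul] at h1
      obtain ⟨s, hs, hs0⟩ := hE.prop.2 _ heE he0
      refine ⟨s * r, ?_, ?_⟩ <;> rw [mul_smul, h1] <;> assumption
    · intro x hx
      exact ⟨C.mkQ x, hgE x hx⟩
  let π : Q →ₗ[R] E := (g ∘ₗ C.mkQ).codRestrict E (fun q => hrange ▸ ⟨C.mkQ q, rfl⟩)
  have hπ : ∀ x : E, π x = x := fun x => Subtype.ext (hgE x x.2)
  refine ⟨ModuleCat.of R E, i.codRestrict E (fun m => hE.prop.1 ⟨m, rfl⟩), ⟨⟨?_⟩, ?_, ?_⟩⟩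
  · intro X Y _ _ _ _ f hf g'
    obtain ⟨h, hh⟩ := hQ.out f hf (E.subtype ∘ₗ g')
    refine ⟨π ∘ₗ h, fun x => ?_⟩
    have : h (f x) = ((g' x : E) : Q) := hh x
    rw [LinearMap.comp_apply, this]
    exact hπ _
  · intro x y hxy
    exact hi (congrArg (fun z : E => (z : Q)) hxy)
  · intro N hN
    rw [Submodule.eq_bot_iff]
    intro x hx
    by_contra hx0
    obtain ⟨r, ⟨m, hm⟩, hr0⟩ := hE.prop.2 x.1 x.2 (fun h => hx0 (Subtype.ext h))
    have hmem : r • x ∈ N ⊓ LinearMap.range (i.codRestrict E (fun m => hE.prop.1 ⟨m, rfl⟩)) :=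
      ⟨N.smul_mem r hx, m, Subtype.ext hm⟩
    rw [hN] at hmem
    exact hr0 (congrArg (fun z : E => (z : Q)) ((Submodule.mem_bot R).1 hmem))

/-- The injective hull `E(R/P)` of `R/P`. -/
noncomputable def primeHull (R : Type u) [CommRing R] (P : PrimeSpectrum R) : ModuleCat.{u} R :=
  (exists_injectiveHull R (R ⧸ P.asIdeal)).choose

/-- The embedding of `R/P` in its injective hull `E(R/P)`. -/
noncomputable def primeHullMap (R : Type u) [CommRing R] (P : PrimeSpectrum R) :
    (R ⧸ P.asIdeal) →ₗ[R] primeHull R P :=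
  (exists_injectiveHull R (R ⧸ P.asIdeal)).choose_spec.choose

theorem isInjectiveHull_primeHullMap (R : Type u) [CommRing R] (P : PrimeSpectrum R) :
    IsInjectiveHull (primeHullMap R P) :=
  (exists_injectiveHull R (R ⧸ P.asIdeal)).choose_spec.choose_spec

theorem isIndecomposable_primeHull (R : Type u) [CommRing R] (P : PrimeSpectrum R) :
    IsIndecomposable R (primeHull R P) := by
  have h := isInjectiveHull_primeHullMap R P
  have hnt : Nontrivial (R ⧸ P.asIdeal) := Ideal.Quotient.nontrivial_iff.2 P.isPrime.ne_top
  refine ⟨h.injective_map.nontrivial, fun A B hAB => ?_⟩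
  by_contra! hne
  have key : ∀ N : Submodule R (primeHull R P), N ≠ ⊥ →
      ∃ r : R, r ∉ P.asIdeal ∧ primeHullMap R P (Ideal.Quotient.mk _ r) ∈ N := by
    intro N hN
    have hN' := mt (h.essential N) hN
    obtain ⟨x, ⟨hxN, z, rfl⟩, hx0⟩ := Submodule.exists_mem_ne_zero_of_ne_bot hN'
    obtain ⟨r, rfl⟩ := Ideal.Quotient.mk_surjective z
    refine ⟨r, fun hr => hx0 ?_, hxN⟩
    rw [Ideal.Quotient.eq_zero_iff_mem.2 hr, map_zero]
  obtain ⟨a, ha, haA⟩ := key A hne.1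
  obtain ⟨b, hb, hbB⟩ := key B hne.2
  have h1 : primeHullMap R P (Ideal.Quotient.mk _ (b * a)) ∈ A := by
    have := A.smul_mem b haA
    rwa [← map_smul] at this
  have h2 : primeHullMap R P (Ideal.Quotient.mk _ (b * a)) ∈ B := by
    have := B.smul_mem a hbB
    rw [mul_comm]
    rwa [← map_smul] at this
  have h0 := Submodule.disjoint_def.1 hAB.disjoint _ h1 h2
  have h3 : Ideal.Quotient.mk P.asIdeal (b * a) = 0 := h.injective_map (by rw [h0, map_zero])
  rcases P.isPrime.mem_or_mem (Ideal.Quotient.eq_zero_iff_mem.1 h3) with h | h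
  exacts [hb h, ha h]

/-! ### The sets `pinj_R`, `inj_R` of isomorphism types -/

/-- Indecomposable pure-injective `R`-modules. -/
structure IndecPureInj (R : Type u) [CommRing R] where
  carrier : ModuleCat.{u} R
  isPureInjective : IsPureInjective R carrier
  isIndecomposable : IsIndecomposable R carrier

/-- Indecomposable injective `R`-modules. -/
structure IndecInj (R : Type u) [CommRing R] where
  carrier : ModuleCat.{u} R
  injective : Module.Injective R carrier
  isIndecomposable : IsIndecomposable R carrier

instance IndecPureInj.setoid (R : Type u) [CommRing R] : Setoid (IndecPureInj R) where
  r M N := Nonempty (M.carrier ≃ₗ[R] N.carrier)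
  iseqv := ⟨fun _ => ⟨LinearEquiv.refl _ _⟩, fun ⟨e⟩ => ⟨e.symm⟩, fun ⟨e⟩ ⟨f⟩ => ⟨e.trans f⟩⟩

instance IndecInj.setoid (R : Type u) [CommRing R] : Setoid (IndecInj R) where
  r M N := Nonempty (M.carrier ≃ₗ[R] N.carrier)
  iseqv := ⟨fun _ => ⟨LinearEquiv.refl _ _⟩, fun ⟨e⟩ => ⟨e.symm⟩, fun ⟨e⟩ ⟨f⟩ => ⟨e.trans f⟩⟩

/-- `pinj_R`: the isomorphism types of indecomposable pure-injective `R`-modules. -/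
def PInj (R : Type u) [CommRing R] : Type (u + 1) := Quotient (IndecPureInj.setoid R)

/-- `inj_R`: the isomorphism types of indecomposable injective `R`-modules. -/
def Inj (R : Type u) [CommRing R] : Type (u + 1) := Quotient (IndecInj.setoid R)

/-- The class in `pinj_R` of an indecomposable pure-injective module. -/
def PInj.mk {R : Type u} [CommRing R] (N : IndecPureInj R) : PInj R := Quotient.mk _ N

/-- The class in `inj_R` of an indecomposable injective module. -/
def Inj.mk {R : Type u} [CommRing R] (E : IndecInj R) : Inj R := Quotient.mk _ E

/-- The inclusion of `inj_R` in `pinj_R`. -/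
def Inj.toPInj (R : Type u) [CommRing R] : Inj R → PInj R :=
  Quotient.map
    (fun E => ⟨E.carrier, fun _ _ _ _ _ _ f hf g => E.injective.out f hf.1 g, E.isIndecomposable⟩)
    (fun _ _ h => h)

/-- The map `P ↦ E(R/P)` from `Spec R` to `inj_R`. -/
noncomputable def specToInj (R : Type u) [CommRing R] (P : PrimeSpectrum R) : Inj R :=
  Inj.mk ⟨primeHull R P, (isInjectiveHull_primeHullMap R P).injective_module,
    isIndecomposable_primeHull R P⟩

/-! ### The topologies -/

/-- The Ziegler topology on `pinj_R`: its basic open sets are the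
`(φ/ψ) = {N | there is a ∈ φ(N) with a ∉ ψ(N)}` for pp formulas `φ, ψ` in the same finite number of
free variables. (Replacing `ψ` by `φ ∧ ψ` does not change the set, so this is the same as using
pp-pairs `ψ ≤ φ`.) -/
abbrev zieglerTopology (R : Type u) [CommRing R] : TopologicalSpace (PInj R) :=
  TopologicalSpace.generateFrom
    {U | ∃ (n : ℕ) (φ ψ : PPFormula R n),
      U = PInj.mk '' {N | ∃ a ∈ φ.solutions N.carrier, a ∉ ψ.solutions N.carrier}}

/-- The full support topology on `pinj_R`: its basic open sets are the `(p/ψ)`, for `p` a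
pp-type (that is, the pp-type of an element `b` of some module `M`) and `ψ` a pp formula, where
`N` is in `(p/ψ)` iff `N` contains an element which satisfies all the formulas in `p` but does not
satisfy `ψ`. -/
abbrev fullSupportTopology (R : Type u) [CommRing R] : TopologicalSpace (PInj R) :=
  TopologicalSpace.generateFrom
    {U | ∃ (M : ModuleCat.{u} R) (b : M) (ψ : PPFormula R 1),
      U = PInj.mk '' {N | ∃ a : N.carrier, ppType R b ⊆ ppType R a ∧ ψ ∉ ppType R a}}

/-- The Thomason (Zariski*) topology on `inj_R`: its basic open sets are the
`(R/I) = {E | Hom(R/I, E) ≠ 0}` with `I` a finitely generated ideal. -/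
abbrev thomasonTopology (R : Type u) [CommRing R] : TopologicalSpace (Inj R) :=
  TopologicalSpace.generateFrom
    {U | ∃ I : Ideal R, I.FG ∧ U = Inj.mk '' {E | ∃ f : (R ⧸ I) →ₗ[R] E.carrier, f ≠ 0}}

/-- The restriction to `Spec R` of the full support topology. -/
noncomputable abbrev fullSupportSpec (R : Type u) [CommRing R] : TopologicalSpace (PrimeSpectrum R) :=
  ((fullSupportTopology R).induced (Inj.toPInj R)).induced (specToInj R)

/-- The restriction to `Spec R` of the Ziegler topology. -/
noncomputable abbrev zieglerSpec (R : Type u) [CommRing R] : TopologicalSpace (PrimeSpectrum R) :=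
  ((zieglerTopology R).induced (Inj.toPInj R)).induced (specToInj R)

/-- The restriction to `Spec R` of the Thomason topology. -/
noncomputable abbrev thomasonSpec (R : Type u) [CommRing R] : TopologicalSpace (PrimeSpectrum R) :=
  (thomasonTopology R).induced (specToInj R)

end ZieglerSpec

namespace ZieglerSpec

/-! ### Positive primitive formulas and linear maps -/

/-! Over an injective module `E`, pp conditions reduce to annihilators. By extension of
homomorphisms, `φ(E)` is the set of tuples killed by a submodule `φ.dual` of `Rⁿ`
(`PPFormula.mem_solutions_iff_of_injective`), and the pp-type of `b ∈ M` is contained in that of `a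
∈ E` exactly when some homomorphism `M → E` sends `b` to `a`.

Hence for each basic open set, membership of `E(R/P)` says that some homomorphism to `E(R/P)` does
not kill some element `x` of a suitable module: `R/I` (Thomason), `Rⁿ/φ.dual` (Ziegler) or `M` (full
support). By `exists_hom_primeHull_ne_zero_iff` this means `ann(x) ⊆ P`, so the traces on `Spec R`
are unions of sets `V(ann x)`. The annihilators are respectively finitely generated, pp-definable
and arbitrary ideals, and each ideal of the class yields a basic open set whose trace is `V(I)`.
Each class contains `0` and is closed under sums, and `V(I + J) = V(I) ∩ V(J)`, so these `V(I)` form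
a basis.

Finitely generated ideals are always pp-definable. Over a coherent ring the converse holds, since a
pp-definable ideal is a projection of the kernel of a matrix. -/

theorem PPFormula.map_mem_solutions {R : Type u} [CommRing R] {n : ℕ} (φ : PPFormula R n)
    {M N : Type*} [AddCommGroup M] [Module R M] [AddCommGroup N] [Module R N] (f : M →ₗ[R] N)
    {x : Fin n → M} (hx : x ∈ φ.solutions M) : (fun j => f (x j)) ∈ φ.solutions N := by
  obtain ⟨y, hy⟩ := hx
  refine ⟨fun j => f (y j), fun i => ?_⟩
  simpa using congrArg f (hy i)

theorem PPFormula.map_mem_solutions_iff {R : Type u} [CommRing R] {n : ℕ} (φ : PPFormula R n)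
    {M N : Type*} [AddCommGroup M] [Module R M] [AddCommGroup N] [Module R N] (e : M ≃ₗ[R] N)
    {x : Fin n → M} : (fun j => e (x j)) ∈ φ.solutions N ↔ x ∈ φ.solutions M :=
  ⟨fun h => by simpa using φ.map_mem_solutions e.symm.toLinearMap h,
    fun h => φ.map_mem_solutions e.toLinearMap h⟩

theorem ppType_subset_map {R : Type u} [CommRing R] {M N : Type*} [AddCommGroup M] [Module R M]
    [AddCommGroup N] [Module R N] (f : M →ₗ[R] N) (b : M) : ppType R b ⊆ ppType R (f b) :=
  fun φ hφ => φ.map_mem_solutions f hφ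

theorem ppType_map_equiv {R : Type u} [CommRing R] {M N : Type*} [AddCommGroup M] [Module R M]
    [AddCommGroup N] [Module R N] (e : M ≃ₗ[R] N) (b : M) : ppType R (e b) = ppType R b :=
  Set.ext fun φ => φ.map_mem_solutions_iff e

/-- A pp formula may be given by a system indexed by arbitrary finite types. -/
theorem exists_ppFormula {R : Type u} [CommRing R] {n : ℕ} {κ ι : Type*} [Fintype κ] [Fintype ι]
    (a : ι → Fin n → R) (b : ι → κ → R) :
    ∃ φ : PPFormula R n, ∀ (M : Type v) [AddCommGroup M] [Module R M] (x : Fin n → M),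
      x ∈ φ.solutions M ↔ ∃ y : κ → M, ∀ i, ∑ j, a i j • x j + ∑ j, b i j • y j = 0 := by
  let e := Fintype.equivFin κ
  let g := Fintype.equivFin ι
  refine ⟨⟨_, _, fun i => a (g.symm i), fun i j => b (g.symm i) (e.symm j)⟩,
    fun M _ _ x => ⟨fun ⟨y, hy⟩ => ⟨fun j => y (e j), fun i => ?_⟩,
      fun ⟨y, hy⟩ => ⟨fun j => y (e.symm j), fun i => ?_⟩⟩⟩
  · have := hy (g i)
    simp only [Equiv.symm_apply_apply] at this
    rw [← this, ← e.sum_comp]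
    simp
  · rw [← hy (g.symm i), ← e.symm.sum_comp (fun j => b (g.symm i) j • y j)]

/-- The formula `r x = 0`. -/
theorem exists_ppFormula_smul_eq_zero {R : Type u} [CommRing R] (r : R) :
    ∃ φ : PPFormula R 1, ∀ (M : Type v) [AddCommGroup M] [Module R M] (x : Fin 1 → M),
      x ∈ φ.solutions M ↔ r • x 0 = 0 := by
  obtain ⟨φ, hφ⟩ := exists_ppFormula.{u, v} (κ := Fin 0) (ι := Fin 1) (fun _ (_ : Fin 1) => r)
    (fun _ => Fin.elim0)
  exact ⟨φ, fun M _ _ x => by simp [hφ M x]⟩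

/-! ### Solutions in injective modules -/

/-- Both maps descend to `A / ker f`, on which `f` becomes an embedding. -/
theorem exists_comp_eq_of_ker_le {R : Type u} [CommRing R] {E A B : Type u} [AddCommGroup E]
    [Module R E] (hE : Module.Injective R E) [AddCommGroup A] [Module R A] [AddCommGroup B]
    [Module R B] (f : A →ₗ[R] B) (g : A →ₗ[R] E) (h : ∀ x, f x = 0 → g x = 0) :
    ∃ k : B →ₗ[R] E, ∀ x, k (f x) = g x := by
  obtain ⟨k, hk⟩ := hE.out ((LinearMap.ker f).liftQ f le_rfl)
    (LinearMap.ker_eq_bot.1 (Submodule.ker_liftQ_eq_bot _ _ _ le_rfl))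
    ((LinearMap.ker f).liftQ g fun x hx => h x hx)
  exact ⟨k, fun x => hk (Submodule.Quotient.mk x)⟩

/-- The solution module in `Rⁿ` of the formula dual to `φ`. -/
def PPFormula.dual {R : Type u} [CommRing R] {n : ℕ} (φ : PPFormula R n) :
    Submodule R (Fin n → R) :=
  (LinearMap.ker (Matrix.vecMulLinear (Matrix.of φ.b))).map (Matrix.vecMulLinear (Matrix.of φ.a))

theorem PPFormula.mem_dual {R : Type u} [CommRing R] {n : ℕ} (φ : PPFormula R n) {d : Fin n → R} :
    d ∈ φ.dual ↔ ∃ r : Fin φ.l → R, (∀ j, ∑ i, r i * φ.b i j = 0) ∧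
      ∀ j, ∑ i, r i * φ.a i j = d j := by
  simp [PPFormula.dual, funext_iff, Matrix.vecMul, dotProduct]

/-- In an injective module a pp formula defines the annihilator of its dual. -/
theorem PPFormula.mem_solutions_iff_of_injective {R : Type u} [CommRing R] {n : ℕ}
    (φ : PPFormula R n) {E : Type u} [AddCommGroup E] [Module R E] (hE : Module.Injective R E)
    (x : Fin n → E) : x ∈ φ.solutions E ↔ ∀ d ∈ φ.dual, ∑ j, d j • x j = 0 := by
  have key : ∀ r : Fin φ.l → R, ∑ j, (∑ i, r i * φ.a i j) • x j =
      ∑ i, r i • ∑ j, φ.a i j • x j := fun r => by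
    simp_rw [Finset.sum_smul, Finset.smul_sum, mul_smul]
    exact Finset.sum_comm
  constructor
  · rintro ⟨y, hy⟩ d hd
    obtain ⟨r, hr, hrd⟩ := φ.mem_dual.1 hd
    simp_rw [← hrd]
    have h2 : ∑ j, (∑ i, r i * φ.b i j) • y j = ∑ i, r i • ∑ j, φ.b i j • y j := by
      simp_rw [Finset.sum_smul, Finset.smul_sum, mul_smul]
      exact Finset.sum_comm
    have h3 : ∑ i, r i • (∑ j, φ.a i j • x j + ∑ j, φ.b i j • y j) = 0 :=
      Finset.sum_eq_zero fun i _ => by rw [hy i, smul_zero]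
    simp_rw [smul_add, Finset.sum_add_distrib] at h3
    rw [← h2, ← key] at h3
    simpa [hr] using h3
  · intro h
    -- The hypothesis on `φ.dual` says that `r ↦ ∑ i, r i • (∑ j, a i j • x j)` vanishes wherever `r
    -- ↦ r b` does, so it extends along `r ↦ r b`. The values of the extension at the standard
    -- basis, with sign changed, solve the system.
    obtain ⟨k, hk⟩ := exists_comp_eq_of_ker_le hE (Matrix.vecMulLinear (Matrix.of φ.b))
      (Fintype.linearCombination R fun i => ∑ j, φ.a i j • x j) (fun r hr => by
        rw [Fintype.linearCombination_apply, ← key]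
        refine h _ (φ.mem_dual.2 ⟨r, fun j => ?_, fun j => rfl⟩)
        simpa [Matrix.vecMul, dotProduct] using congrFun hr j)
    refine ⟨fun j => -k (Pi.single j 1), fun i => ?_⟩
    have hi := hk (Pi.single i 1)
    rw [Fintype.linearCombination_apply_single, one_smul] at hi
    rw [← hi, ← Finset.univ_sum_single (Matrix.vecMulLinear (Matrix.of φ.b) (Pi.single i 1)),
      map_sum, ← Finset.sum_add_distrib]
    refine Finset.sum_eq_zero fun j _ => ?_
    have : (Pi.single j (φ.b i j) : Fin φ.k → R) = φ.b i j • Pi.single j 1 := by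
      rw [← Pi.single_smul, smul_eq_mul, mul_one]
    simp [this]

/-- The formulas `r x = 0` already suffice: they make `r • b ↦ r • a` well defined on `R b`, and
injectivity of `E` extends it to `M`. -/
theorem ppType_subset_iff_of_injective {R : Type u} [CommRing R] {M E : Type u} [AddCommGroup M]
    [Module R M] [AddCommGroup E] [Module R E] (hE : Module.Injective R E) (b : M) (a : E) :
    ppType R b ⊆ ppType R a ↔ ∃ h : M →ₗ[R] E, h b = a := by
  refine ⟨fun h => ?_, fun ⟨h, hb⟩ => hb ▸ ppType_subset_map h b⟩
  obtain ⟨k, hk⟩ := exists_comp_eq_of_ker_le hE (LinearMap.toSpanSingleton R M b)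
    (LinearMap.toSpanSingleton R E a) (fun r hr => by
      obtain ⟨φ, hφ⟩ := exists_ppFormula_smul_eq_zero.{u, u} r
      exact (hφ E _).1 (h ((hφ M _).2 hr)))
  exact ⟨k, by simpa using hk 1⟩

/-! ### The injective hulls `E(R/P)` -/

theorem exists_smul_eq_primeHullMap {R : Type u} [CommRing R] {P : PrimeSpectrum R}
    {e : primeHull R P} (he : e ≠ 0) :
    ∃ r t : R, t ∉ P.asIdeal ∧ r • e = primeHullMap R P (Ideal.Quotient.mk _ t) := by
  obtain ⟨x, ⟨hx, z, rfl⟩, hx0⟩ := Submodule.exists_mem_ne_zero_of_ne_bot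
    (mt ((isInjectiveHull_primeHullMap R P).essential (Submodule.span R {e}))
      (by simpa using he))
  obtain ⟨r, hr⟩ := Submodule.mem_span_singleton.1 hx
  obtain ⟨t, rfl⟩ := Ideal.Quotient.mk_surjective z
  exact ⟨r, t, fun ht => hx0 (by rw [Ideal.Quotient.eq_zero_iff_mem.2 ht, map_zero]), hr⟩

theorem smul_primeHullMap_eq_zero_iff {R : Type u} [CommRing R] {P : PrimeSpectrum R} {s t : R}
    (ht : t ∉ P.asIdeal) :
    s • primeHullMap R P (Ideal.Quotient.mk _ t) = 0 ↔ s ∈ P.asIdeal := by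
  rw [← map_smul, map_eq_zero_iff _ (isInjectiveHull_primeHullMap R P).injective_map,
    Algebra.smul_def, Ideal.Quotient.algebraMap_eq, ← map_mul, Ideal.Quotient.eq_zero_iff_mem]
  exact ⟨fun h => (P.isPrime.mem_or_mem h).resolve_right ht, fun h => Ideal.mul_mem_right _ _ h⟩

theorem one_notMem_asIdeal {R : Type u} [CommRing R] (P : PrimeSpectrum R) : (1 : R) ∉ P.asIdeal :=
  (Ideal.ne_top_iff_one _).1 P.isPrime.ne_top

/-- Some homomorphism to `E(R/P)` does not kill `x` iff the annihilator of `x` lies in `P`. -/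
theorem exists_hom_primeHull_ne_zero_iff {R : Type u} [CommRing R] (P : PrimeSpectrum R)
    {M : Type u} [AddCommGroup M] [Module R M] (x : M) :
    (∃ h : M →ₗ[R] primeHull R P, h x ≠ 0) ↔ ∀ s : R, s • x = 0 → s ∈ P.asIdeal := by
  constructor
  · rintro ⟨h, hx⟩ s hs
    -- By essentiality a multiple of `h x` is a nonzero element of `R/P`, so its annihilator is
    -- exactly `P`; whatever kills `x` kills it.
    obtain ⟨r, t, ht, hr⟩ := exists_smul_eq_primeHullMap hx
    rw [← smul_primeHullMap_eq_zero_iff ht, ← hr, smul_comm, ← map_smul, hs, map_zero, smul_zero]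
  · intro hx
    have h1 := one_notMem_asIdeal P
    obtain ⟨k, hk⟩ := exists_comp_eq_of_ker_le (isInjectiveHull_primeHullMap R P).injective_module
      (LinearMap.toSpanSingleton R M x)
      (LinearMap.toSpanSingleton R _ (primeHullMap R P (Ideal.Quotient.mk _ 1)))
      (fun s hs => (smul_primeHullMap_eq_zero_iff h1).2 (hx s hs))
    refine ⟨k, fun h0 => h1 ((smul_primeHullMap_eq_zero_iff h1).1 ?_)⟩
    have := hk 1
    simp only [LinearMap.toSpanSingleton_apply, one_smul] at this
    rw [one_smul, ← this, h0]

/-- The image of `1 ∈ R/P` has annihilator `P`. An isomorphism to `E(R/Q)` does not kill it, so `P ⊆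
Q`; then symmetry applies. -/
theorem specToInj_injective (R : Type u) [CommRing R] : Function.Injective (specToInj R) := by
  have key : ∀ P Q : PrimeSpectrum R, (primeHull R P ≃ₗ[R] primeHull R Q) →
      P.asIdeal ≤ Q.asIdeal := by
    intro P Q e s hs
    have h1 := one_notMem_asIdeal P
    refine (exists_hom_primeHull_ne_zero_iff Q (primeHullMap R P (Ideal.Quotient.mk _ 1))).1
      ⟨e, fun h0 => h1 ((smul_primeHullMap_eq_zero_iff h1).1 ?_)⟩ s
      ((smul_primeHullMap_eq_zero_iff h1).2 hs)
    rw [one_smul]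
    exact e.map_eq_zero_iff.1 h0
  intro P Q h
  obtain ⟨e⟩ := Quotient.exact h
  exact PrimeSpectrum.ext (le_antisymm (key P Q e) (key Q P e.symm))

/-! ### The traces on `Spec R` of the basic open sets -/

theorem specToInj_mem_image_iff {R : Type u} [CommRing R] (p : ModuleCat.{u} R → Prop)
    (hp : ∀ M N : ModuleCat.{u} R, (M ≃ₗ[R] N) → p M → p N) (P : PrimeSpectrum R) :
    specToInj R P ∈ Inj.mk '' {E | p E.carrier} ↔ p (primeHull R P) := by
  constructor
  · rintro ⟨N, hN, h⟩
    obtain ⟨e⟩ := Quotient.exact h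
    exact hp _ _ e hN
  · exact fun h => ⟨_, h, rfl⟩

theorem toPInj_specToInj_mem_image_iff {R : Type u} [CommRing R] (p : ModuleCat.{u} R → Prop)
    (hp : ∀ M N : ModuleCat.{u} R, (M ≃ₗ[R] N) → p M → p N) (P : PrimeSpectrum R) :
    Inj.toPInj R (specToInj R P) ∈ PInj.mk '' {N | p N.carrier} ↔ p (primeHull R P) := by
  constructor
  · rintro ⟨N, hN, h⟩
    obtain ⟨e⟩ := Quotient.exact h
    exact hp _ _ e hN
  · exact fun h => ⟨⟨primeHull R P, _, isIndecomposable_primeHull R P⟩, h, rfl⟩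

theorem thomason_basic_iff {R : Type u} [CommRing R] (I : Ideal R) (P : PrimeSpectrum R) :
    specToInj R P ∈ Inj.mk '' {E | ∃ f : (R ⧸ I) →ₗ[R] E.carrier, f ≠ 0} ↔
      P ∈ PrimeSpectrum.zeroLocus (I : Set R) := by
  rw [specToInj_mem_image_iff (fun E => ∃ f : (R ⧸ I) →ₗ[R] E, f ≠ 0) fun M N e ⟨f, hf⟩ =>
    ⟨e.toLinearMap ∘ₗ f, fun h => hf (LinearMap.ext fun x => e.injective (by
      simpa using LinearMap.congr_fun h x))⟩]
  have : ∀ f : (R ⧸ I) →ₗ[R] primeHull R P, f ≠ 0 ↔ f (Ideal.Quotient.mk I 1) ≠ 0 := by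
    refine fun f => not_congr ⟨fun h => by rw [h]; rfl, fun h => LinearMap.ext fun z => ?_⟩
    obtain ⟨r, rfl⟩ := Ideal.Quotient.mk_surjective z
    have h2 : Ideal.Quotient.mk I r = r • Ideal.Quotient.mk I 1 := by
      rw [Algebra.smul_def, Ideal.Quotient.algebraMap_eq, map_one, mul_one]
    rw [h2, map_smul, h, smul_zero, LinearMap.zero_apply]
  simp_rw [this, exists_hom_primeHull_ne_zero_iff]
  simp [Algebra.smul_def, Ideal.Quotient.eq_zero_iff_mem, PrimeSpectrum.mem_zeroLocus,
    Set.subset_def]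

theorem fullSupport_basic_iff {R : Type u} [CommRing R] (M : ModuleCat.{u} R) (b : M)
    (ψ : PPFormula R 1) (P : PrimeSpectrum R) :
    Inj.toPInj R (specToInj R P) ∈
        PInj.mk '' {N | ∃ a : N.carrier, ppType R b ⊆ ppType R a ∧ ψ ∉ ppType R a} ↔
      ∃ d ∈ ψ.dual, ∀ s : R, (s * d 0) • b = 0 → s ∈ P.asIdeal := by
  rw [toPInj_specToInj_mem_image_iff
    (fun N => ∃ a : N, ppType R b ⊆ ppType R a ∧ ψ ∉ ppType R a) fun N N' e ⟨a, h⟩ =>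
      ⟨e a, by rwa [ppType_map_equiv]⟩]
  have hE := (isInjectiveHull_primeHullMap R P).injective_module
  simp_rw [ppType_subset_iff_of_injective hE, mul_smul, ← exists_hom_primeHull_ne_zero_iff]
  have : ∀ a : primeHull R P, ψ ∉ ppType R a ↔ ∃ d ∈ ψ.dual, d 0 • a ≠ 0 := fun a => by
    refine (not_congr (ψ.mem_solutions_iff_of_injective hE (fun _ => a))).trans ?_
    simp only [Fin.sum_univ_one, not_forall, exists_prop, ne_eq]
  simp_rw [this, map_smul]
  constructor
  · rintro ⟨_, ⟨h, rfl⟩, d, hd, hn⟩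
    exact ⟨d, hd, h, hn⟩
  · rintro ⟨d, hd, h, hn⟩
    exact ⟨_, ⟨h, rfl⟩, d, hd, hn⟩

/-- Tuples in `φ(E)` correspond to homomorphisms `Rⁿ/φ.dual → E`, and such a tuple fails `ψ` when
the homomorphism does not kill the class of some `d ∈ ψ.dual`. The annihilator of that class is
`(φ.dual : d)`. -/
theorem ziegler_basic_iff {R : Type u} [CommRing R] {n : ℕ} (φ ψ : PPFormula R n)
    (P : PrimeSpectrum R) :
    Inj.toPInj R (specToInj R P) ∈
        PInj.mk '' {N | ∃ a ∈ φ.solutions N.carrier, a ∉ ψ.solutions N.carrier} ↔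
      ∃ d ∈ ψ.dual, ∀ s : R, s • d ∈ φ.dual → s ∈ P.asIdeal := by
  rw [toPInj_specToInj_mem_image_iff
    (fun N => ∃ a ∈ φ.solutions N, a ∉ ψ.solutions N) fun N N' e ⟨a, h⟩ =>
      ⟨fun j => e (a j), by rwa [φ.map_mem_solutions_iff, ψ.map_mem_solutions_iff]⟩]
  have hE := (isInjectiveHull_primeHullMap R P).injective_module
  simp_rw [φ.mem_solutions_iff_of_injective hE, ψ.mem_solutions_iff_of_injective hE]
  have : ∀ d : Fin n → R, (∀ s : R, s • d ∈ φ.dual → s ∈ P.asIdeal) ↔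
      ∃ h : ((Fin n → R) ⧸ φ.dual) →ₗ[R] primeHull R P, h (φ.dual.mkQ d) ≠ 0 := fun d => by
    simp_rw [exists_hom_primeHull_ne_zero_iff, ← map_smul, Submodule.mkQ_apply,
      Submodule.Quotient.mk_eq_zero]
  simp_rw [this]
  push Not
  constructor
  · rintro ⟨a, ha, d, hd, hn⟩
    exact ⟨d, hd, φ.dual.liftQ (Fintype.linearCombination R a) fun c hc => ha c hc, hn⟩
  · rintro ⟨d, hd, h, hn⟩
    have hs : ∀ c : Fin n → R,
        ∑ j, c j • h (φ.dual.mkQ (Pi.single j 1)) = h (φ.dual.mkQ c) := fun c => by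
      conv_rhs => rw [← Finset.univ_sum_single c, map_sum, map_sum]
      refine Finset.sum_congr rfl fun j _ => ?_
      rw [← map_smul, ← map_smul, ← Pi.single_smul, smul_eq_mul, mul_one]
    refine ⟨fun j => h (φ.dual.mkQ (Pi.single j 1)), fun c hc => ?_, d, hd, by rwa [hs]⟩
    rw [hs, Submodule.mkQ_apply, (Submodule.Quotient.mk_eq_zero _).2 hc, map_zero]

/-! ### Positive primitive definable ideals -/

theorem isPPDefinable_of_system {R : Type u} [CommRing R] {I : Ideal R} {κ ι : Type*} [Fintype κ]
    [Fintype ι] (a : ι → R) (b : ι → κ → R)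
    (h : ∀ r, r ∈ I ↔ ∃ y : κ → R, ∀ i, a i * r + ∑ j, b i j * y j = 0) : IsPPDefinable I := by
  obtain ⟨φ, hφ⟩ := exists_ppFormula.{u, u} (fun i (_ : Fin 1) => a i) b
  exact ⟨φ, fun r => by simp [h, hφ]⟩

theorem isPPDefinable_of_fg {R : Type u} [CommRing R] {I : Ideal R} (hI : I.FG) :
    IsPPDefinable I := by
  obtain ⟨n, g, rfl⟩ := Submodule.fg_iff_exists_fin_generating_family.1 hI
  refine isPPDefinable_of_system (ι := Unit) (fun _ => -1) (fun _ => g) fun r => ?_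
  rw [Submodule.mem_span_range_iff_exists_fun]
  refine exists_congr fun c => ?_
  simp only [smul_eq_mul, forall_const, neg_mul, one_mul, neg_add_eq_zero]
  simp_rw [mul_comm (g _)]
  exact eq_comm

theorem IsPPDefinable.sup {R : Type u} [CommRing R] {I J : Ideal R} (hI : IsPPDefinable I)
    (hJ : IsPPDefinable J) : IsPPDefinable (I ⊔ J) := by
  obtain ⟨φ, hφ⟩ := hI
  obtain ⟨ψ, hψ⟩ := hJ
  -- The `Unit` variable is the summand `x ∈ I`; the equations express `φ(x)` and `ψ(r - x)`.
  refine isPPDefinable_of_system (κ := Unit ⊕ (Fin φ.k ⊕ Fin ψ.k)) (ι := Fin φ.l ⊕ Fin ψ.l)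
    (Sum.elim (fun _ => 0) fun i => ψ.a i 0)
    (Sum.elim (fun i => Sum.elim (fun _ => φ.a i 0) (Sum.elim (φ.b i) 0))
      (fun i => Sum.elim (fun _ => -ψ.a i 0) (Sum.elim 0 (ψ.b i)))) fun r => ?_
  simp only [Submodule.mem_sup, hφ, hψ, PPFormula.solutions, Set.mem_ofPred_eq, Sum.forall,
    Fintype.sum_sum_type, Sum.elim_inl, Sum.elim_inr, Pi.zero_apply, zero_mul, Finset.univ_unique,
    Finset.sum_singleton, smul_eq_mul, Finset.sum_const_zero, add_zero, zero_add]
  constructor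
  · rintro ⟨x, ⟨y, hy⟩, x', ⟨z, hz⟩, rfl⟩
    refine ⟨Sum.elim (fun _ => x) (Sum.elim y z), fun i => by simpa using hy i, fun i => ?_⟩
    rw [← hz i]
    simp only [Sum.elim_inl, Sum.elim_inr, Fin.isValue, Fin.default_eq_zero]
    ring
  · rintro ⟨w, h1, h2⟩
    refine ⟨w (.inl ()), ⟨fun j => w (.inr (.inl j)), fun i => by simpa using h1 i⟩,
      r - w (.inl ()), ⟨fun j => w (.inr (.inr j)), fun i => ?_⟩, by ring⟩
    rw [← h2 i]
    simp only [Fin.isValue, Fin.default_eq_zero, PUnit.default_eq_unit]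
    ring

theorem isPPDefinable_dual_comap {R : Type u} [CommRing R] {n : ℕ} (φ : PPFormula R n)
    (d : Fin n → R) : IsPPDefinable (φ.dual.comap (LinearMap.toSpanSingleton R _ d)) := by
  refine isPPDefinable_of_system (κ := Fin φ.l) (ι := Fin φ.k ⊕ Fin n)
    (Sum.elim (fun _ => 0) fun j => -d j)
    (Sum.elim (fun j i => φ.b i j) fun j i => φ.a i j) fun s => ?_
  simp only [Submodule.mem_comap, LinearMap.toSpanSingleton_apply, φ.mem_dual, Sum.forall,
    Sum.elim_inl, Sum.elim_inr, zero_mul, zero_add, Pi.smul_apply, smul_eq_mul, neg_mul,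
    neg_add_eq_zero]
  simp_rw [mul_comm _ (d _), mul_comm (φ.b _ _), mul_comm (φ.a _ _)]
  exact exists_congr fun r => and_congr Iff.rfl (forall_congr' fun j => eq_comm)

/-- Every pp-definable ideal is the dual of some pp formula. -/
theorem IsPPDefinable.exists_dual {R : Type u} [CommRing R] {I : Ideal R} (hI : IsPPDefinable I) :
    ∃ φ : PPFormula R 1, ∀ r : R, (fun _ => r) ∈ φ.dual ↔ r ∈ I := by
  obtain ⟨φ, hφ⟩ := hI
  -- The system is transposed: the multiplier vector in `PPFormula.mem_dual` becomes `(r, y)`, the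
  -- old equations become the relations on it, and the new `a` reads off its coordinate `0`.
  refine ⟨⟨φ.l, φ.k + 1, Fin.cons (fun _ => 1) fun _ _ => 0,
    Fin.cons (fun i => φ.a i 0) fun j i => φ.b i j⟩, fun r => ?_⟩
  rw [PPFormula.mem_dual, hφ]
  simp only [Fin.sum_univ_succ, Fin.cons_zero, Fin.cons_succ, mul_one, mul_zero,
    Finset.sum_const_zero, add_zero, forall_const, PPFormula.solutions, Set.mem_ofPred_eq,
    Finset.univ_unique, Finset.sum_singleton, Fin.default_eq_zero, smul_eq_mul]
  constructor
  · rintro ⟨w, hw, rfl⟩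
    exact ⟨fun j => w j.succ, fun i => by simpa [mul_comm] using hw i⟩
  · rintro ⟨y, hy⟩
    exact ⟨Fin.cons r y, fun i => by simpa [mul_comm] using hy i, rfl⟩

/-- The image `f(N)` is a finitely generated ideal, hence finitely presented, so the kernel of `N →
f(N)` is finitely generated. -/
theorem IsCoherentRing.fg_inf_ker {R : Type u} [CommRing R] (hR : IsCoherentRing R) {M : Type*}
    [AddCommGroup M] [Module R M] {N : Submodule R M} (hN : N.FG) (f : M →ₗ[R] R) :
    (N ⊓ LinearMap.ker f).FG := by
  have : Module.Finite R N := Module.Finite.iff_fg.2 hN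
  let g : N →ₗ[R] R := f ∘ₗ N.subtype
  have : Module.FinitePresentation R (LinearMap.range g) :=
    hR _ (Module.Finite.iff_fg.1 inferInstance)
  have h := (Module.FinitePresentation.fg_ker g.rangeRestrict g.surjective_rangeRestrict).map
    N.subtype
  rwa [LinearMap.ker_rangeRestrict, LinearMap.ker_comp, Submodule.map_comap_subtype] at h

theorem IsCoherentRing.fg_iInf_ker {R : Type u} [CommRing R] (hR : IsCoherentRing R) {M : Type*}
    [AddCommGroup M] [Module R M] [Module.Finite R M] {ι : Type*} (s : Finset ι)
    (f : ι → M →ₗ[R] R) : (⨅ i ∈ s, LinearMap.ker (f i)).FG := by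
  classical
  induction s using Finset.induction_on with
  | empty => simpa using Module.Finite.fg_top
  | insert i s _ ih =>
    rw [Finset.iInf_insert, inf_comm]
    exact hR.fg_inf_ker ih (f i)

theorem IsCoherentRing.fg_of_isPPDefinable {R : Type u} [CommRing R] (hR : IsCoherentRing R)
    {I : Ideal R} (hI : IsPPDefinable I) : I.FG := by
  obtain ⟨φ, hφ⟩ := hI
  let f : Fin φ.l → (R × (Fin φ.k → R)) →ₗ[R] R := fun i =>
    (LinearMap.mulLeft R (φ.a i 0)).coprod (Fintype.linearCombination R (φ.b i))
  suffices h : I = (⨅ i ∈ Finset.univ, LinearMap.ker (f i)).map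
      (LinearMap.fst R R (Fin φ.k → R)) from h ▸ (hR.fg_iInf_ker Finset.univ f).map _
  ext r
  rw [hφ]
  simp [PPFormula.solutions, f, Fintype.linearCombination_apply, mul_comm]

/-! ### The induced topologies -/

/-- A description of the open sets of a generated topology by a basis closed under finite
intersections. -/
theorem isOpen_generateFrom_iff_of_basis {X : Type*} {B : Set (Set X)} {ι : Type*} (C : Set ι)
    (V : ι → Set X) (h_univ : ∃ i ∈ C, V i = Set.univ)
    (h_inter : ∀ i ∈ C, ∀ j ∈ C, ∃ k ∈ C, V k = V i ∩ V j)
    (hB : ∀ U ∈ B, ∀ x ∈ U, ∃ i ∈ C, x ∈ V i ∧ V i ⊆ U) (hC : ∀ i ∈ C, V i ∈ B) (U : Set X) :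
    IsOpen[TopologicalSpace.generateFrom B] U ↔
      ∃ S : Set ι, (∀ i ∈ S, i ∈ C) ∧ U = ⋃ i ∈ S, V i := by
  constructor
  · intro hU
    have key : ∀ x ∈ U, ∃ i ∈ C, x ∈ V i ∧ V i ⊆ U := by
      induction hU with
      | basic U hU => exact hB U hU
      | univ =>
        intro x _
        obtain ⟨i, hi, h⟩ := h_univ
        exact ⟨i, hi, h ▸ Set.mem_univ x, Set.subset_univ _⟩
      | inter U W _ _ hU hW =>
        rintro x ⟨hxU, hxW⟩
        obtain ⟨i, hi, hxi, hiU⟩ := hU x hxU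
        obtain ⟨j, hj, hxj, hjW⟩ := hW x hxW
        obtain ⟨k, hk, h⟩ := h_inter i hi j hj
        exact ⟨k, hk, h ▸ ⟨hxi, hxj⟩, h ▸ Set.inter_subset_inter hiU hjW⟩
      | sUnion S _ h =>
        rintro x ⟨U, hU, hx⟩
        obtain ⟨i, hi, hxi, hiU⟩ := h U hU x hx
        exact ⟨i, hi, hxi, hiU.trans (Set.subset_sUnion_of_mem hU)⟩
    refine ⟨{i | i ∈ C ∧ V i ⊆ U}, fun i hi => hi.1, Set.Subset.antisymm (fun x hx => ?_) ?_⟩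
    · obtain ⟨i, hi, hxi, hiU⟩ := key x hx
      exact Set.mem_biUnion (show i ∈ {i | i ∈ C ∧ V i ⊆ U} from ⟨hi, hiU⟩) hxi
    · exact Set.iUnion₂_subset fun i hi => hi.2
  · rintro ⟨S, hS, rfl⟩
    let := TopologicalSpace.generateFrom B
    exact isOpen_biUnion fun i hi => TopologicalSpace.isOpen_generateFrom_of_mem (hC i (hS i hi))

theorem isOpen_generateFrom_iff_zeroLocus {R : Type u} [CommRing R]
    {B : Set (Set (PrimeSpectrum R))} (C : Set (Ideal R)) (h_bot : ⊥ ∈ C)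
    (h_sup : ∀ I ∈ C, ∀ J ∈ C, I ⊔ J ∈ C)
    (hB : ∀ U ∈ B, ∀ P ∈ U, ∃ I ∈ C, P ∈ PrimeSpectrum.zeroLocus (I : Set R) ∧
      PrimeSpectrum.zeroLocus (I : Set R) ⊆ U)
    (hC : ∀ I ∈ C, PrimeSpectrum.zeroLocus (I : Set R) ∈ B) (U : Set (PrimeSpectrum R)) :
    IsOpen[TopologicalSpace.generateFrom B] U ↔
      ∃ S : Set (Ideal R), (∀ I ∈ S, I ∈ C) ∧ U = ⋃ I ∈ S, PrimeSpectrum.zeroLocus (I : Set R) :=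
  isOpen_generateFrom_iff_of_basis C (fun I : Ideal R => PrimeSpectrum.zeroLocus (I : Set R))
    ⟨⊥, h_bot, PrimeSpectrum.zeroLocus_bot⟩
    (fun I hI J hJ => ⟨I ⊔ J, h_sup I hI J hJ, PrimeSpectrum.zeroLocus_sup I J⟩) hB hC U

theorem isOpen_thomasonSpec_iff {R : Type u} [CommRing R] (U : Set (PrimeSpectrum R)) :
    IsOpen[thomasonSpec R] U ↔ ∃ S : Set (Ideal R), (∀ I ∈ S, I.FG) ∧
      U = ⋃ I ∈ S, PrimeSpectrum.zeroLocus (I : Set R) := by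
  rw [thomasonSpec, thomasonTopology, induced_generateFrom_eq]
  refine isOpen_generateFrom_iff_zeroLocus {I | I.FG} Submodule.fg_bot
    (fun I hI J hJ => Submodule.FG.sup hI hJ) ?_ ?_ U
  · rintro _ ⟨_, ⟨I, hI, rfl⟩, rfl⟩ P hP
    exact ⟨I, hI, (thomason_basic_iff I P).1 hP, fun Q hQ => (thomason_basic_iff I Q).2 hQ⟩
  · exact fun I hI => ⟨_, ⟨I, hI, rfl⟩, Set.ext fun P => thomason_basic_iff I P⟩

/-- Such a `ψ` defines `0` in every injective module, so it serves as `x = 0` in the basic open sets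
that realise `V(I)`. -/
theorem exists_dual_eq_top (R : Type u) [CommRing R] : ∃ ψ : PPFormula R 1, ψ.dual = ⊤ := by
  obtain ⟨ψ, hψ⟩ := (isPPDefinable_of_fg (R := R) (I := ⊤) Module.Finite.fg_top).exists_dual
  refine ⟨ψ, Submodule.eq_top_iff'.2 fun d => ?_⟩
  have : d = fun _ => d 0 := funext fun j => by rw [Subsingleton.elim j 0]
  rw [this, hψ]
  trivial

theorem isOpen_zieglerSpec_iff {R : Type u} [CommRing R] (U : Set (PrimeSpectrum R)) :
    IsOpen[zieglerSpec R] U ↔ ∃ S : Set (Ideal R), (∀ I ∈ S, IsPPDefinable I) ∧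
      U = ⋃ I ∈ S, PrimeSpectrum.zeroLocus (I : Set R) := by
  rw [zieglerSpec, zieglerTopology, induced_generateFrom_eq, induced_generateFrom_eq]
  refine isOpen_generateFrom_iff_zeroLocus {I | IsPPDefinable I}
    (isPPDefinable_of_fg Submodule.fg_bot) (fun I hI J hJ => IsPPDefinable.sup hI hJ) ?_ ?_ U
  · rintro _ ⟨_, ⟨_, ⟨n, φ, ψ, rfl⟩, rfl⟩, rfl⟩ P hP
    obtain ⟨d, hd, h⟩ := (ziegler_basic_iff φ ψ P).1 hP
    exact ⟨_, isPPDefinable_dual_comap φ d, fun s hs => h s hs,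
      fun Q hQ => (ziegler_basic_iff φ ψ Q).2 ⟨d, hd, fun s hs => hQ hs⟩⟩
  · intro I hI
    obtain ⟨φ, hφ⟩ := IsPPDefinable.exists_dual hI
    obtain ⟨ψ, hψ⟩ := exists_dual_eq_top R
    refine ⟨_, ⟨_, ⟨1, φ, ψ, rfl⟩, rfl⟩, Set.ext fun P => (ziegler_basic_iff φ ψ P).trans ?_⟩
    -- As `I ⊆ (I : d)`, every `d` gives a subset of `V(I)`, and `d = 1` gives all of it.
    constructor
    · rintro ⟨d, -, h⟩ s hs
      refine h s ?_
      have : s • d = fun _ => s * d 0 := funext fun j => by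
        rw [Subsingleton.elim j 0, Pi.smul_apply, smul_eq_mul]
      rw [this, hφ]
      exact I.mul_mem_right _ hs
    · intro hP
      refine ⟨fun _ => 1, hψ ▸ trivial, fun s hs => hP ((hφ s).1 ?_)⟩
      convert hs
      simp

theorem isOpen_fullSupportSpec_iff {R : Type u} [CommRing R] (U : Set (PrimeSpectrum R)) :
    IsOpen[fullSupportSpec R] U ↔ ∃ S : Set (Ideal R),
      U = ⋃ I ∈ S, PrimeSpectrum.zeroLocus (I : Set R) := by
  rw [fullSupportSpec, fullSupportTopology, induced_generateFrom_eq, induced_generateFrom_eq]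
  refine (isOpen_generateFrom_iff_zeroLocus Set.univ trivial (fun _ _ _ _ => trivial)
    ?_ ?_ U).trans (by simp)
  · rintro _ ⟨_, ⟨_, ⟨M, b, ψ, rfl⟩, rfl⟩, rfl⟩ P hP
    obtain ⟨d, hd, h⟩ := (fullSupport_basic_iff M b ψ P).1 hP
    -- All ideals are allowed here, so it is enough that the trace contains `V(P)` along with `P`.
    exact ⟨P.asIdeal, trivial, fun s hs => hs,
      fun Q hQ => (fullSupport_basic_iff M b ψ Q).2 ⟨d, hd, fun s hs => hQ (h s hs)⟩⟩
  · intro I _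
    obtain ⟨ψ, hψ⟩ := exists_dual_eq_top R
    refine ⟨_, ⟨_, ⟨ModuleCat.of R (R ⧸ I), (1 : R ⧸ I), ψ, rfl⟩, rfl⟩,
      Set.ext fun P => (fullSupport_basic_iff _ _ ψ P).trans ?_⟩
    have h1 : ∀ r : R, r • (1 : R ⧸ I) = 0 ↔ r ∈ I := fun r => by
      rw [Algebra.smul_def, Ideal.Quotient.algebraMap_eq, mul_one, Ideal.Quotient.eq_zero_iff_mem]
    constructor
    · rintro ⟨d, -, h⟩ s hs
      exact h s ((h1 _).2 (I.mul_mem_right _ hs))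
    · intro hP
      exact ⟨fun _ => 1, hψ ▸ trivial, fun s hs => hP (by simpa using (h1 _).1 hs)⟩

theorem stableUnderSpecialization_iff_exists_zeroLocus {R : Type u} [CommRing R]
    (U : Set (PrimeSpectrum R)) : StableUnderSpecialization U ↔
      ∃ S : Set (Ideal R), U = ⋃ I ∈ S, PrimeSpectrum.zeroLocus (I : Set R) := by
  constructor
  · intro hU
    -- `V(P)` is the set of specialisations of `P`, so `U` is the union of the `V(P)` with `P ∈ U`.
    refine ⟨PrimeSpectrum.asIdeal '' U, Set.Subset.antisymm (fun P hP => ?_) ?_⟩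
    · exact Set.mem_biUnion (Set.mem_image_of_mem _ hP) (fun s hs => hs)
    · refine Set.iUnion₂_subset ?_
      rintro _ ⟨P, hP, rfl⟩ Q hQ
      exact hU ((PrimeSpectrum.le_iff_specializes P Q).1 hQ) hP
  · rintro ⟨S, rfl⟩
    exact stableUnderSpecialization_iUnion _ fun I =>
      stableUnderSpecialization_iUnion _ fun _ =>
        (PrimeSpectrum.isClosed_zeroLocus _).stableUnderSpecialization

end ZieglerSpec

theorem corollary6p4 (R : Type u) [CommRing R] :
    -- `P ↦ E(R/P)` embeds `Spec R` into `inj_R`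
    Function.Injective (ZieglerSpec.specToInj R) ∧
    -- full support topology
    (∀ U : Set (PrimeSpectrum R),
      (IsOpen[ZieglerSpec.fullSupportSpec R] U ↔
        ∃ S : Set (Ideal R), U = ⋃ I ∈ S, PrimeSpectrum.zeroLocus (I : Set R)) ∧
      (IsOpen[ZieglerSpec.fullSupportSpec R] U ↔ StableUnderSpecialization U)) ∧
    -- Ziegler topology
    (∀ U : Set (PrimeSpectrum R),
      IsOpen[ZieglerSpec.zieglerSpec R] U ↔
        ∃ S : Set (Ideal R), (∀ I ∈ S, ZieglerSpec.IsPPDefinable I) ∧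
          U = ⋃ I ∈ S, PrimeSpectrum.zeroLocus (I : Set R)) ∧
    -- Thomason topology
    (∀ U : Set (PrimeSpectrum R),
      IsOpen[ZieglerSpec.thomasonSpec R] U ↔
        ∃ S : Set (Ideal R), (∀ I ∈ S, I.FG) ∧
          U = ⋃ I ∈ S, PrimeSpectrum.zeroLocus (I : Set R)) ∧
    (ZieglerSpec.IsCoherentRing R → ZieglerSpec.zieglerSpec R = ZieglerSpec.thomasonSpec R) ∧
    (IsNoetherianRing R →
      ZieglerSpec.fullSupportSpec R = ZieglerSpec.zieglerSpec R ∧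
      ZieglerSpec.zieglerSpec R = ZieglerSpec.thomasonSpec R) := by
  refine ⟨ZieglerSpec.specToInj_injective R,
    fun U => ⟨ZieglerSpec.isOpen_fullSupportSpec_iff U,
      (ZieglerSpec.isOpen_fullSupportSpec_iff U).trans
        (ZieglerSpec.stableUnderSpecialization_iff_exists_zeroLocus U).symm⟩,
    ZieglerSpec.isOpen_zieglerSpec_iff, ZieglerSpec.isOpen_thomasonSpec_iff, fun hR => ?_,
    fun hR => ⟨?_, ?_⟩⟩ <;>
    refine TopologicalSpace.ext_iff.2 fun U => ?_
  · rw [ZieglerSpec.isOpen_zieglerSpec_iff, ZieglerSpec.isOpen_thomasonSpec_iff]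
    exact exists_congr fun S => and_congr_left fun _ => forall₂_congr fun I _ =>
      ⟨hR.fg_of_isPPDefinable, ZieglerSpec.isPPDefinable_of_fg⟩
  · rw [ZieglerSpec.isOpen_fullSupportSpec_iff, ZieglerSpec.isOpen_zieglerSpec_iff]
    exact exists_congr fun S => (and_iff_right fun I _ =>
      ZieglerSpec.isPPDefinable_of_fg (IsNoetherian.noetherian I)).symm
  · rw [ZieglerSpec.isOpen_zieglerSpec_iff, ZieglerSpec.isOpen_thomasonSpec_iff]
    exact exists_congr fun S => and_congr_left fun _ => forall₂_congr fun I _ =>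
      ⟨fun _ => IsNoetherian.noetherian I, ZieglerSpec.isPPDefinable_of_fg⟩
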